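/- Let $G$ be a connected Lie group with universal cover $\tilde G$, regard $\pi_1(G)$ as a central subgroup of $\tilde G$, and let $G^\delta$ be $G$ with the discrete topology. Let $o^\delta(EG)\in H^2(BG^\delta,\pi_1(G))$ be the pull-back to $BG^\delta$ of the primary obstruction $o(EG)\in H^2(BG,\pi_1(G))$ to a section of the universal $G$-bundle $EG\to BG$; equivalently, by naturality, the primary obstruction to a section of the flat $G$-bundle $EG^\delta\times_{G^\delta}G\to BG^\delta$. Let $|\cdot|$ be the word length on the finitely generated abelian group $\pi_1(G)$ with respect to some finite symmetric generating set (or, if $\pi_1(G)$ is realized as a discrete subgroup of some $\mathbb R^r$, the restriction of the Euclidean norm). For a class $\alpha\in H^2(BG^\delta,\pi_1(G))=H^2(G^\delta,\pi_1(G))$ put $$\|\alpha\|_\infty=\inf_{[c]=\alpha}\ \sup_{g,h\in G}|c(g,h)|\in[0,\infty],$$ the infimum over all cocycles $c:G\times G\to\pi_1(G)$ representing $\alpha$, and call $\alpha$ bounded if it is represented by a cocycle with bounded image. For $z\in[\tilde G,\tilde G]$ let $\mathrm{cl}(z)$ be the least number of commutators of elements of $\tilde G$ whose product is $z$, and $\mathrm{scl}(z)=\lim_{n\to\infty}\mathrm{cl}(z^n)/n$.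 Assume that $o^\delta(EG)$ is bounded, and let $z\in\pi_1(G)$ be an element of infinite order that lies in $[\tilde G,\tilde G]$. Then the limits $\mathrm{scl}(z)$ and $\lim_{n\to\infty}|z^n|/n$ exist, and $$\mathrm{scl}(z)\ \ge\ \frac{1}{4\,\|o^\delta(EG)\|_\infty}\,\lim_{n\to\infty}\frac{|z^n|}{n}\ >\ 0 .$$ -/

import Mathlib

open Filter Topology
open scoped unitInterval Manifold ContDiff

universe u

namespace FlatObstruction

noncomputable section

/-! ### Commutator length, stable commutator length, word length -/

/-- The commutator length of `z` in the group `H`: the smallest number of commutators whose product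
is `z` (only meaningful for `z` in the commutator subgroup of `H`). -/
def commutatorLength {H : Type*} [Group H] (z : H) : ℕ :=
  sInf {k | ∃ l : List (H × H), l.length = k ∧
    (l.map fun p => p.1 * p.2 * p.1⁻¹ * p.2⁻¹).prod = z}

/-- The stable commutator length `lim cl(zⁿ)/n`. -/
def stableCommutatorLength {H : Type*} [Group H] (z : H) : ℝ :=
  limUnder atTop fun n : ℕ => (commutatorLength (z ^ n) : ℝ) / n

/-- The word length of `h` with respect to `S`: the smallest number of elements of `S`
(a finite symmetric generating set in all uses) needed to express `h`. -/
def wordLength {H : Type*} [Group H] (S : Finset H) (h : H) : ℕ :=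
  sInf {k | ∃ l : List H, l.length = k ∧ (∀ x ∈ l, x ∈ S) ∧ l.prod = h}

/-- The length functions that are used on a finitely generated abelian group `A`: the word length
with respect to a finite symmetric generating set and, when `A` is realized as a discrete subgroup
of some `ℝ^r`, the restriction of the Euclidean norm. -/
inductive IsStandardLength {A : Type*} [CommGroup A] : (A → ℝ) → Prop
  | word (S : Finset A) (symm : ∀ s ∈ S, s⁻¹ ∈ S) (gen : Subgroup.closure (S : Set A) = ⊤) :
      IsStandardLength fun a => (wordLength S a : ℝ)
  | euclidean (r : ℕ) (φ : Additive A →+ EuclideanSpace ℝ (Fin r)) (inj : Function.Injective φ)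
      (discrete : DiscreteTopology φ.range) :
      IsStandardLength fun a => ‖φ (Additive.ofMul a)‖

/-- The limit `lim |zⁿ|/n` for a length function `|·|`. -/
def stableLength {H : Type*} [Group H] (len : H → ℝ) (z : H) : ℝ :=
  limUnder atTop fun n : ℕ => len (z ^ n) / n

/-! ### Bounded classes in degree-two group cohomology -/

section Cohomology

variable {Γ A : Type u} [Group Γ] [CommGroup A]

/-- `A` as a trivial `Γ`-module. The ring of scalars is `ℤ`, lifted to the universe of `Γ`. -/
abbrev trivialModule (Γ A : Type u) [Group Γ] [CommGroup A] : Rep.{u} (ULift.{u} ℤ) Γ :=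
  Rep.trivial (ULift.{u} ℤ) Γ (Additive A)

/-- `H²(Γ, A) = H²(BΓ, A)` for the discrete group `Γ` and trivial coefficients `A`. -/
abbrev H2 (Γ A : Type u) [Group Γ] [CommGroup A] : Type u :=
  groupCohomology.H2 (trivialModule Γ A)

/-- The inhomogeneous two-cocycles `Γ × Γ → A`. -/
abbrev Cocycle (Γ A : Type u) [Group Γ] [CommGroup A] : Type u :=
  groupCohomology.cocycles₂ (trivialModule Γ A)

/-- The cohomology class of a two-cocycle. -/
def Cocycle.toClass (c : Cocycle Γ A) : H2 Γ A :=
  groupCohomology.H2π (trivialModule Γ A) c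

/-- The value of a two-cocycle, as an element of the (multiplicatively written) group `A`. -/
def Cocycle.val (c : Cocycle Γ A) (g h : Γ) : A :=
  Additive.toMul (α := A) (c (g, h))

/-- A class is bounded if it is represented by a cocycle with bounded image, for the length
function `len` on `A`. -/
def IsBoundedClass (len : A → ℝ) (α : H2 Γ A) : Prop :=
  ∃ c : Cocycle Γ A, c.toClass = α ∧ ∃ C : ℝ, ∀ g h, len (c.val g h) ≤ C

/-- `‖α‖_∞`: the infimum, over all cocycles representing `α`, of the supremum of the length of
the values (lengths are nonnegative). -/
def supNorm (len : A → ℝ) (α : H2 Γ A) : ENNReal :=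
  ⨅ (c : Cocycle Γ A) (_ : c.toClass = α), ⨆ (g : Γ) (h : Γ), ENNReal.ofReal (len (c.val g h))

end Cohomology

/-! ### The universal cover of a topological group -/

section UniversalCover

theorem homotopic_trans_refl {X : Type*} [TopologicalSpace X] {x y : X} (p : Path x y) :
    p.Homotopic (p.trans (Path.refl y)) :=
  ⟨(Path.Homotopy.transRefl p).symm⟩

theorem homotopic_refl_trans {X : Type*} [TopologicalSpace X] {x y : X} (p : Path x y) :
    p.Homotopic ((Path.refl x).trans p) :=
  ⟨(Path.Homotopy.reflTrans p).symm⟩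

variable (G : Type u) [TopologicalSpace G] [Group G] [IsTopologicalGroup G]

/-- The group, under pointwise multiplication, of the paths in `G` that start at `1`. -/
def basedPaths : Subgroup C(I, G) where
  carrier := {f | f 0 = 1}
  one_mem' := rfl
  mul_mem' := by
    intro a b ha hb
    simp only [Set.mem_ofPred_eq] at ha hb ⊢
    simp [ha, hb]
  inv_mem' := by
    intro a ha
    simp only [Set.mem_ofPred_eq] at ha ⊢
    simp [ha]

/-- Homotopy of paths relative to the end points is a congruence on the group of paths. -/
def homotopyCon : Con (basedPaths G) where
  r f g := ContinuousMap.HomotopicRel (f : C(I, G)) (g : C(I, G)) {0, 1}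
  iseqv :=
    ⟨fun f => ContinuousMap.HomotopicRel.refl _, fun h => h.symm, fun h h' => h.trans h'⟩
  mul' := by
    rintro a b c d ⟨F⟩ ⟨F'⟩
    refine ⟨⟨⟨⟨fun x => F x * F' x, by fun_prop⟩, ?_, ?_⟩, ?_⟩⟩
    · intro x
      simp
    · intro x
      simp
    · intro t x hx
      have h1 := F.prop' t x hx
      have h2 := F'.prop' t x hx
      simp only [ContinuousMap.coe_mk] at h1 h2 ⊢
      exact congrArg₂ (· * ·) h1 h2

/-- The universal cover of `G`, as an abstract group: homotopy classes, relative to the end points,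
of the paths in `G` starting at `1`, with pointwise multiplication. (Commutators, and hence the
stable commutator length, do not involve its topology.) -/
def UniversalCover : Type u := (homotopyCon G).Quotient

instance : Group (UniversalCover G) := inferInstanceAs (Group (homotopyCon G).Quotient)

variable {G}

/-- The point of the universal cover given by a path starting at `1`. -/
def ofPath {g : G} (p : Path (1 : G) g) : UniversalCover G :=
  (homotopyCon G).mk' ⟨p.toContinuousMap, p.source⟩

variable (G) in
/-- The covering homomorphism: a path is sent to its end point. -/
def coveringMap : UniversalCover G →* G :=
  (homotopyCon G).lift
    { toFun := fun f => f.1 1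
      map_one' := rfl
      map_mul' := fun _ _ => rfl }
    (by
      rintro f g ⟨F⟩
      have h := F.eq_fst 1 (x := 1) (by simp)
      rw [F.apply_one] at h
      exact h.symm)

theorem ofPath_eq_iff {g : G} {p q : Path (1 : G) g} : ofPath p = ofPath q ↔ p.Homotopic q :=
  (homotopyCon G).eq

/-- The path `g · p` from `g` to `g h`, for a path `p` from `1` to `h`. -/
def translate (g : G) {h : G} (p : Path (1 : G) h) : Path g (g * h) :=
  (p.map (continuous_const_mul g)).cast (mul_one g).symm rfl

theorem ofPath_mul_of {g h k : G} {p p' : Path 1 g} {q q' : Path 1 h} {r : Path 1 k}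
    (hp : p.Homotopic p') (hq : q.Homotopic q') (hr : ∀ t, r t = p' t * q' t) :
    ofPath p * ofPath q = ofPath r := by
  rw [ofPath_eq_iff.2 hp, ofPath_eq_iff.2 hq]
  refine congrArg (homotopyCon G).mk' (Subtype.ext (ContinuousMap.ext fun t => ?_))
  exact (hr t).symm

theorem ofPath_mul {g h : G} (p : Path (1 : G) g) (q : Path (1 : G) h) :
    ofPath p * ofPath q = ofPath (p.trans (translate g q)) := by
  refine ofPath_mul_of (homotopic_trans_refl p) (homotopic_refl_trans q) fun t => ?_
  simp only [Path.trans_apply, translate]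
  split_ifs <;> simp

theorem ofPath_loop_mul {g : G} (l : Path (1 : G) 1) (p : Path (1 : G) g) :
    ofPath l * ofPath p = ofPath (l.trans p) := by
  refine ofPath_mul_of (homotopic_trans_refl l) (homotopic_refl_trans p) fun t => ?_
  simp only [Path.trans_apply]
  split_ifs <;> simp

theorem ofPath_mul_loop {g : G} (l : Path (1 : G) 1) (p : Path (1 : G) g) :
    ofPath p * ofPath l = ofPath (l.trans p) := by
  refine ofPath_mul_of (homotopic_refl_trans p) (homotopic_trans_refl l) fun t => ?_
  simp only [Path.trans_apply]
  split_ifs <;> simp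

theorem ofPath_surjective (x : UniversalCover G) :
    ∃ (g : G) (p : Path (1 : G) g), ofPath p = x := by
  obtain ⟨f, rfl⟩ := (homotopyCon G).mk'_surjective x
  exact ⟨f.1 1, ⟨f.1, f.2, rfl⟩, rfl⟩

/-- The natural embedding of `π₁(G) = π₁(G, 1)` in the universal cover: a loop at `1` is, in
particular, a path starting at `1`. -/
def toCover : FundamentalGroup G 1 →* UniversalCover G where
  toFun := Quotient.lift (fun l : Path (1 : G) 1 => ofPath l) fun _ _ h => ofPath_eq_iff.2 h
  map_one' := rfl
  map_mul' := by
    intro a b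
    induction a using Quotient.inductionOn with | _ p
    induction b using Quotient.inductionOn with | _ q
    exact (ofPath_mul_loop q p).symm

theorem toCover_injective : Function.Injective (toCover (G := G)) := by
  intro a b
  induction a using Quotient.inductionOn with | _ p
  induction b using Quotient.inductionOn with | _ q
  exact fun h => Quotient.sound (ofPath_eq_iff.1 h)

theorem toCover_central (a : FundamentalGroup G 1) (x : UniversalCover G) :
    toCover a * x = x * toCover a := by
  obtain ⟨g, p, rfl⟩ := ofPath_surjective x
  induction a using Quotient.inductionOn with | _ l
  exact (ofPath_loop_mul l p).trans (ofPath_mul_loop l p).symm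

/-- The image of `π₁(G)` in the universal cover is the kernel of the covering homomorphism. -/
theorem range_toCover : (toCover (G := G)).range = (coveringMap G).ker := by
  ext x
  constructor
  · rintro ⟨a, rfl⟩
    induction a using Quotient.inductionOn with | _ l
    exact l.target
  · intro hx
    obtain ⟨g, p, rfl⟩ := ofPath_surjective x
    obtain rfl : g = 1 := p.target.symm.trans hx
    exact ⟨FundamentalGroup.fromPath (Path.Homotopic.Quotient.mk p), rfl⟩

/-- The fundamental group of a topological group is commutative. -/
instance : CommGroup (FundamentalGroup G (1 : G)) :=
  { (inferInstance : Group (FundamentalGroup G (1 : G))) with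
    mul_comm := fun a b => toCover_injective <| by
      rw [map_mul, map_mul]
      exact toCover_central a _ }

end UniversalCover

/-! ### The class `o^δ(EG)`

The pull-back to `BG^δ` of the universal `G`-bundle is the flat bundle `EG^δ ×_{G^δ} G → BG^δ`, and
its sections over a subcomplex of `BG^δ` are the `G`-equivariant maps to `G` (with the action by
left translations) from the part of `EG^δ` above that subcomplex. We use the bar construction for
`EG^δ → BG^δ`: the `n`-simplices of `EG^δ` are the `(n+1)`-tuples in `G`, the vertex `g` is sent
to `g`, and an equivariant map on the one-skeleton amounts to a path `γ g` from `1` to `g` for each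
`g`, the edge `(a, a g)` being sent to `a · γ g`. The obstruction to extending this section over
the two-simplex `(1, g, g h)` is the class in `π₁(G)` of the image of its boundary, and the class in
`H²(BG^δ, π₁(G))` of this obstruction cocycle is the primary obstruction to a section. -/

section Obstruction

variable {G : Type u} [TopologicalSpace G] [Group G] [IsTopologicalGroup G]

/-- The obstruction cochain of a section over the one-skeleton: on the two-simplex `(1, g, g h)` it
is the class of the loop which runs along `γ g` from `1` to `g`, then along `g · γ h` from `g` to
`g h`, and then back to `1` along `γ (g h)`. -/
def obstructionCochain (γ : ∀ g : G, Path (1 : G) g) (g h : G) : FundamentalGroup G 1 :=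
  FundamentalGroup.fromPath <| Path.Homotopic.Quotient.mk <|
    ((γ g).trans (translate g (γ h))).trans (γ (g * h)).symm

theorem toCover_obstructionCochain (γ : ∀ g : G, Path (1 : G) g) (g h : G) :
    toCover (obstructionCochain γ g h) * ofPath (γ (g * h)) = ofPath (γ g) * ofPath (γ h) := by
  rw [ofPath_mul]
  refine (ofPath_loop_mul _ _).trans (ofPath_eq_iff.2 ?_)
  rw [← Path.Homotopic.Quotient.eq]
  simp [Path.Homotopic.Quotient.trans_assoc]

/-- The obstruction cochain is a cocycle. -/
def obstructionCocycle (γ : ∀ g : G, Path (1 : G) g) : Cocycle G (FundamentalGroup G (1 : G)) :=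
  ⟨fun p => Additive.ofMul (obstructionCochain γ p.1 p.2), by
    refine (groupCohomology.mem_cocycles₂_iff _).2 ?_
    intro g h j
    refine Additive.toMul.injective ?_
    change obstructionCochain γ (g * h) j * obstructionCochain γ g h =
      obstructionCochain γ h j * obstructionCochain γ g (h * j)
    refine toCover_injective ?_
    rw [map_mul, map_mul, ← mul_left_inj (ofPath (γ (g * h * j)))]
    have e1 := toCover_obstructionCochain γ g h
    have e2 := toCover_obstructionCochain γ (g * h) j
    have e3 := toCover_obstructionCochain γ h j
    have e4 := toCover_obstructionCochain γ g (h * j)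
    rw [toCover_central, mul_assoc, e2, ← mul_assoc, e1, mul_assoc, mul_assoc (toCover _),
      mul_assoc g h j, e4, ← mul_assoc, toCover_central, mul_assoc (ofPath _) _ (toCover _),
      ← toCover_central, e3, mul_assoc]⟩

/-- The class of the obstruction cocycle does not depend on the section over the one-skeleton. -/
theorem obstructionCocycle_toClass_eq (γ γ' : ∀ g : G, Path (1 : G) g) :
    (obstructionCocycle γ).toClass = (obstructionCocycle γ').toClass := by
  refine (groupCohomology.H2π_eq_iff _ _).2 ?_
  let b : G → FundamentalGroup G (1 : G) := fun g =>
    FundamentalGroup.fromPath (Path.Homotopic.Quotient.mk ((γ g).trans (γ' g).symm))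
  have hb : ∀ g, toCover (b g) * ofPath (γ' g) = ofPath (γ g) := fun g => by
    refine (ofPath_loop_mul _ _).trans (ofPath_eq_iff.2 ?_)
    rw [← Path.Homotopic.Quotient.eq]
    simp [Path.Homotopic.Quotient.trans_assoc]
  refine ⟨fun g => Additive.ofMul (b g), funext fun p => ?_⟩
  obtain ⟨g, h⟩ := p
  refine Additive.toMul.injective ?_
  change b h / b (g * h) * b g = obstructionCochain γ g h / obstructionCochain γ' g h
  suffices H : obstructionCochain γ g h * b (g * h) = b g * b h * obstructionCochain γ' g h by
    rw [div_mul_eq_mul_div, div_eq_div_iff_mul_eq_mul, H, mul_comm (b h) (b g)]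
  refine toCover_injective ?_
  have e1 := toCover_obstructionCochain γ g h
  have e2 := toCover_obstructionCochain γ' g h
  rw [← mul_left_inj (ofPath (γ' (g * h))), map_mul, map_mul, map_mul, mul_assoc, hb, e1,
    mul_assoc, e2, ← hb g, ← hb h, mul_assoc, mul_assoc, ← mul_assoc (ofPath (γ' g)),
    ← toCover_central]
  simp only [mul_assoc]

variable (G) in
/-- The class `o^δ(EG) ∈ H²(BG^δ, π₁(G))` of a path connected topological group `G`. -/
def obstructionClass [PathConnectedSpace G] : H2 G (FundamentalGroup G (1 : G)) :=
  (obstructionCocycle fun g : G => PathConnectedSpace.somePath 1 g).toClass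

end Obstruction

/-- A connected manifold is path connected. -/
theorem pathConnectedSpace_of_manifold (E : Type*) [NormedAddCommGroup E] [NormedSpace ℝ E]
    (M : Type*) [TopologicalSpace M] [ChartedSpace E M] [ConnectedSpace M] :
    PathConnectedSpace M := by
  have : LocallyPathConnectedSpace M := ChartedSpace.locallyPathConnectedSpace E M
  exact pathConnectedSpace_iff_connectedSpace.2 inferInstance

end

end FlatObstruction

namespace FlatObstruction

/-! ### Limits of subadditive sequences -/

/-! The universal cover is a central extension of `G` by `π₁(G)`, and every cocycle `c` in the
obstruction class comes from a set-theoretic section `s` with `s g * s h = c g h * s (g * h)`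
(`exists_section_of_toClass_eq`). Commutators ignore central factors, so those in the cover are
commutators of values of `s`. Absorbing one of them into a single value of `s` costs four values of
`c` (`commutator_mul_section_eq`). If `|c| ≤ C`, a central `z` therefore satisfies `|z| ≤ (4 cl(z) +
2) C` (`len_le_mul_commutatorLength`). Applying this to `zⁿ`, dividing by `n` and letting `n → ∞`
removes the additive constant. Letting `C` decrease to the norm of the class then gives the
inequality.

Both limits exist by subadditivity. The stable length is positive because a homomorphism to `ℤ`, or
the linearity of the Euclidean embedding, makes `|zⁿ|` grow linearly. This in turn forces the norm
to be positive. -/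

theorem tendsto_limUnder_div_of_subadditive {u : ℕ → ℝ} (h : Subadditive u) (h0 : ∀ n, 0 ≤ u n) :
    Tendsto (fun n : ℕ => u n / n) atTop (𝓝 (limUnder atTop fun n : ℕ => u n / n)) := by
  have hbdd : BddBelow (Set.range fun n : ℕ => u n / n) :=
    ⟨0, by rintro _ ⟨n, rfl⟩; exact div_nonneg (h0 n) n.cast_nonneg⟩
  -- Fekete's lemma.
  have ht := h.tendsto_lim hbdd
  rwa [← ht.limUnder_eq] at ht

/-! ### Commutator length -/

section CommutatorLength

variable {H : Type*} [Group H]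

/-- The product of the commutators of a list of pairs. -/
def commutatorProd (l : List (H × H)) : H :=
  (l.map fun p => p.1 * p.2 * p.1⁻¹ * p.2⁻¹).prod

theorem exists_commutatorProd_eq {z : H} (hz : z ∈ commutator H) :
    ∃ l : List (H × H), commutatorProd l = z := by
  rw [commutator_eq_closure] at hz
  induction hz using Subgroup.closure_induction with
  | mem x hx =>
    obtain ⟨a, b, rfl⟩ := hx
    exact ⟨[(a, b)], by simp [commutatorProd, commutatorElement_def]⟩
  | one => exact ⟨[], rfl⟩
  | mul x y _ _ hx hy =>
    obtain ⟨l, rfl⟩ := hx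
    obtain ⟨l', rfl⟩ := hy
    exact ⟨l ++ l', by simp [commutatorProd]⟩
  | inv x _ hx =>
    obtain ⟨l, rfl⟩ := hx
    -- The inverse of `[a, b]` is `[b, a]`.
    refine ⟨(l.map Prod.swap).reverse, ?_⟩
    rw [commutatorProd, commutatorProd, List.prod_inv_reverse, List.map_reverse]
    simp [mul_assoc, Function.comp_def]

/-- Membership in the commutator subgroup makes the set under `sInf` nonempty, so its default value
0 does not intervene. -/
theorem exists_length_eq_commutatorLength {z : H} (hz : z ∈ commutator H) :
    ∃ l : List (H × H), l.length = commutatorLength z ∧ commutatorProd l = z := by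
  obtain ⟨l, hl⟩ := exists_commutatorProd_eq hz
  exact Nat.sInf_mem (s := {k | ∃ l : List (H × H), l.length = k ∧ commutatorProd l = z})
    ⟨_, l, rfl, hl⟩

theorem commutatorLength_commutatorProd_le (l : List (H × H)) :
    commutatorLength (commutatorProd l) ≤ l.length :=
  Nat.sInf_le ⟨l, rfl, rfl⟩

theorem commutatorLength_mul_le {x y : H} (hx : x ∈ commutator H) (hy : y ∈ commutator H) :
    commutatorLength (x * y) ≤ commutatorLength x + commutatorLength y := by
  obtain ⟨l, hl, rfl⟩ := exists_length_eq_commutatorLength hx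
  obtain ⟨l', hl', rfl⟩ := exists_length_eq_commutatorLength hy
  rw [← hl, ← hl', ← List.length_append]
  have : commutatorProd l * commutatorProd l' = commutatorProd (l ++ l') := by
    simp [commutatorProd]
  rw [this]
  exact commutatorLength_commutatorProd_le _

theorem tendsto_stableCommutatorLength {z : H} (hz : z ∈ commutator H) :
    Tendsto (fun n : ℕ => (commutatorLength (z ^ n) : ℝ) / n) atTop
      (𝓝 (stableCommutatorLength z)) := by
  refine tendsto_limUnder_div_of_subadditive (fun m n => ?_) fun n => Nat.cast_nonneg _
  rw [pow_add]
  exact_mod_cast commutatorLength_mul_le (pow_mem hz m) (pow_mem hz n)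

end CommutatorLength

/-! ### Word length -/

section WordLength

variable {A : Type*}

theorem wordLength_prod_le [Group A] {S : Finset A} {l : List A} (hl : ∀ x ∈ l, x ∈ S) :
    wordLength S l.prod ≤ l.length :=
  Nat.sInf_le ⟨l, rfl, hl, rfl⟩

theorem exists_length_eq_wordLength [Group A] {S : Finset A} (symm : ∀ s ∈ S, s⁻¹ ∈ S)
    (gen : Subgroup.closure (S : Set A) = ⊤) (a : A) :
    ∃ l : List A, l.length = wordLength S a ∧ (∀ x ∈ l, x ∈ S) ∧ l.prod = a := by
  have ha : a ∈ Subgroup.closure (S : Set A) := gen ▸ Subgroup.mem_top a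
  rw [← Subgroup.mem_toSubmonoid, Subgroup.closure_toSubmonoid] at ha
  obtain ⟨l, hl, hla⟩ := Submonoid.exists_list_of_mem_closure ha
  refine Nat.sInf_mem (s := {k | ∃ l : List A, l.length = k ∧ (∀ x ∈ l, x ∈ S) ∧ l.prod = a})
    ⟨_, l, rfl, fun x hx => ?_, hla⟩
  rcases hl x hx with h | h
  · exact h
  · simpa using symm _ h

theorem wordLength_mul_le [Group A] {S : Finset A} (symm : ∀ s ∈ S, s⁻¹ ∈ S)
    (gen : Subgroup.closure (S : Set A) = ⊤) (a b : A) :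
    wordLength S (a * b) ≤ wordLength S a + wordLength S b := by
  obtain ⟨l, hl, hlS, rfl⟩ := exists_length_eq_wordLength symm gen a
  obtain ⟨l', hl', hlS', rfl⟩ := exists_length_eq_wordLength symm gen b
  rw [← hl, ← hl', ← List.length_append, ← List.prod_append]
  exact wordLength_prod_le fun x hx => (List.mem_append.1 hx).elim (hlS x) (hlS' x)

theorem wordLength_inv_le [Group A] {S : Finset A} (symm : ∀ s ∈ S, s⁻¹ ∈ S)
    (gen : Subgroup.closure (S : Set A) = ⊤) (a : A) :
    wordLength S a⁻¹ ≤ wordLength S a := by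
  obtain ⟨l, hl, hlS, rfl⟩ := exists_length_eq_wordLength symm gen a
  rw [← hl, List.prod_inv_reverse]
  refine (wordLength_prod_le fun x hx => ?_).trans (by simp)
  obtain ⟨y, hy, rfl⟩ := List.mem_map.1 (List.mem_reverse.1 hx)
  exact symm y (hlS y hy)

/-- An element of infinite order of a finitely generated abelian group is detected by a
homomorphism to the integers. -/
theorem exists_addMonoidHom_int_ne_zero [AddCommGroup A] [AddGroup.FG A] {z : A}
    (hz : ¬ IsOfFinAddOrder z) : ∃ f : A →+ ℤ, f z ≠ 0 := by
  have : Module.Finite ℤ A := Module.Finite.iff_addGroup_fg.2 inferInstance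
  let q := (Submodule.torsion ℤ A).mkQ
  have hq : q z ≠ 0 := by
    intro h
    obtain ⟨a, ha⟩ := (Submodule.mem_torsion_iff z).1 ((Submodule.Quotient.mk_eq_zero _).1 h)
    exact hz (isOfFinAddOrder_iff_zsmul_eq_zero.2 ⟨a, nonZeroDivisors.ne_zero a.2, ha⟩)
  -- The quotient by torsion is finitely generated and torsion-free, hence free, and its coordinates
  -- separate points.
  by_contra! H
  refine hq ((Module.Free.chooseBasis ℤ (A ⧸ Submodule.torsion ℤ A)).ext_elem fun i => ?_)
  simpa [q] using H (((Module.Free.chooseBasis ℤ (A ⧸ Submodule.torsion ℤ A)).coord i ∘ₗ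
    q).toAddMonoidHom)

theorem exists_pos_mul_le_wordLength_pow [CommGroup A] {S : Finset A}
    (symm : ∀ s ∈ S, s⁻¹ ∈ S) (gen : Subgroup.closure (S : Set A) = ⊤) {z : A}
    (hz : ¬ IsOfFinOrder z) : ∃ δ : ℝ, 0 < δ ∧ ∀ n : ℕ, δ * n ≤ wordLength S (z ^ n) := by
  have : Group.FG A := ⟨⟨S, gen⟩⟩
  obtain ⟨f, hf⟩ := exists_addMonoidHom_int_ne_zero (z := Additive.ofMul z)
    (by rwa [isOfFinAddOrder_ofMul_iff])
  -- A Lipschitz constant of `f` for the word length; since `|f (zⁿ)| = n |f z| ≥ n`, its inverse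
  -- serves as `δ`.
  let M : ℕ := ∑ s ∈ S, (f (Additive.ofMul s)).natAbs
  have hlist : ∀ l : List A, (∀ x ∈ l, x ∈ S) →
      (f (Additive.ofMul l.prod)).natAbs ≤ M * l.length := by
    intro l
    induction l with
    | nil => simp
    | cons a l ih =>
      intro h
      have h1 := ih fun x hx => h x (List.mem_cons_of_mem _ hx)
      have h2 : (f (Additive.ofMul a)).natAbs ≤ M :=
        Finset.single_le_sum (f := fun s => (f (Additive.ofMul s)).natAbs)
          (fun _ _ => Nat.zero_le _) (h a List.mem_cons_self)
      rw [List.prod_cons, ofMul_mul, map_add, List.length_cons, mul_add_one]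
      exact (Int.natAbs_add_le _ _).trans (by omega)
  have hM : ∀ n : ℕ, n ≤ M * wordLength S (z ^ n) := by
    intro n
    obtain ⟨l, hl, hlS, hlz⟩ := exists_length_eq_wordLength symm gen (z ^ n)
    have h := hlist l hlS
    rw [hlz, hl, ofMul_pow, map_nsmul, nsmul_eq_mul, Int.natAbs_mul, Int.natAbs_natCast] at h
    exact (Nat.le_mul_of_pos_right n (Int.natAbs_pos.2 hf)).trans h
  have hM0 : 0 < (M : ℝ) := by
    refine Nat.cast_pos.2 (Nat.pos_of_ne_zero fun h => ?_)
    have := hM 1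
    simp [h] at this
  refine ⟨(M : ℝ)⁻¹, inv_pos.2 hM0, fun n => ?_⟩
  rw [inv_mul_le_iff₀ hM0]
  exact_mod_cast hM n

end WordLength

/-! ### Standard length functions -/

namespace IsStandardLength

variable {A : Type*} [CommGroup A] {len : A → ℝ}

theorem nonneg (h : IsStandardLength len) (a : A) : 0 ≤ len a := by
  cases h with
  | word S symm gen => exact Nat.cast_nonneg _
  | euclidean r φ inj discrete => exact norm_nonneg _

theorem mul_le (h : IsStandardLength len) (a b : A) : len (a * b) ≤ len a + len b := by
  cases h with
  | word S symm gen =>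
    dsimp only
    exact_mod_cast wordLength_mul_le symm gen a b
  | euclidean r φ inj discrete =>
    simp only [ofMul_mul, map_add]
    exact norm_add_le _ _

theorem inv_le (h : IsStandardLength len) (a : A) : len a⁻¹ ≤ len a := by
  cases h with
  | word S symm gen =>
    dsimp only
    exact_mod_cast wordLength_inv_le symm gen a
  | euclidean r φ inj discrete => simp

theorem exists_pos_mul_le_pow (h : IsStandardLength len) {z : A} (hz : ¬ IsOfFinOrder z) :
    ∃ δ : ℝ, 0 < δ ∧ ∀ n : ℕ, δ * n ≤ len (z ^ n) := by
  cases h with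
  | word S symm gen => exact exists_pos_mul_le_wordLength_pow symm gen hz
  | euclidean r φ inj discrete =>
    refine ⟨‖φ (Additive.ofMul z)‖, norm_pos_iff.2 fun h => hz ?_, fun n => ?_⟩
    · have h1 : z = 1 := ofMul_eq_zero.1 ((map_eq_zero_iff φ inj).1 h)
      exact h1 ▸ IsOfFinOrder.one
    · dsimp only
      rw [ofMul_pow, map_nsmul, ← Nat.cast_smul_eq_nsmul ℝ, norm_smul, Real.norm_natCast, mul_comm]

theorem tendsto_stableLength (h : IsStandardLength len) (z : A) :
    Tendsto (fun n : ℕ => len (z ^ n) / n) atTop (𝓝 (stableLength len z)) := by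
  refine tendsto_limUnder_div_of_subadditive (fun m n => ?_) fun n => h.nonneg _
  rw [pow_add]
  exact h.mul_le _ _

theorem stableLength_pos (h : IsStandardLength len) {z : A} (hz : ¬ IsOfFinOrder z) :
    0 < stableLength len z := by
  obtain ⟨δ, hδ, hle⟩ := h.exists_pos_mul_le_pow hz
  refine hδ.trans_le (ge_of_tendsto (h.tendsto_stableLength z) ?_)
  filter_upwards [eventually_gt_atTop 0] with n hn
  exact (le_div_iff₀ (Nat.cast_pos.2 hn)).2 (hle n)

end IsStandardLength

/-! ### Commutators in a central extension given by a bounded cocycle -/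

section CentralExtension

variable {Γ A H : Type*} [Group Γ] [CommGroup A] [Group H] {ι : A →* H} {s : Γ → H}
  {c : Γ → Γ → A}

/-- With `w = [g, h]`, write `[s g, s h] = (s g * s h) * (s h * s g)⁻¹` and compare `s (g * h)` with
`s w * s (h * g)`, using `w * (h * g) = g * h`. This uses three values of `c`; merging `s w * s k`
uses the fourth. -/
theorem commutator_mul_section_eq (hι : ∀ a x, ι a * x = x * ι a)
    (hs : ∀ g h, ι (c g h) * s (g * h) = s g * s h) (g h k : Γ) :
    s g * s h * (s g)⁻¹ * (s h)⁻¹ * s k =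
      ι (c g h * (c h g)⁻¹ * (c (g * h * g⁻¹ * h⁻¹) (h * g))⁻¹ * c (g * h * g⁻¹ * h⁻¹) k) *
        s (g * h * g⁻¹ * h⁻¹ * k) := by
  set w := g * h * g⁻¹ * h⁻¹ with hw
  have hwm : w * (h * g) = g * h := by rw [hw]; group
  have e1 := hs g h
  have e2 := hs h g
  have e3 := hs w (h * g)
  have e4 := hs w k
  rw [hwm] at e3
  have hcomm : s g * s h * (s g)⁻¹ * (s h)⁻¹ = (s g * s h) * (s h * s g)⁻¹ := by group
  have h1 : s (g * h) = (ι (c w (h * g)))⁻¹ * (s w * s (h * g)) := by rw [← e3]; group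
  rw [hcomm, ← e1, ← e2, h1, map_mul, mul_assoc _ (ι (c w k)), e4]
  simp only [map_mul, map_inv, mul_inv_rev]
  have c1 : ∀ x, (ι (c h g))⁻¹ * x = x * (ι (c h g))⁻¹ := fun x => by
    rw [← map_inv]; exact hι _ x
  simp only [mul_assoc, c1, mul_inv_cancel_left]

theorem exists_commutatorProd_eq_mul_section {π : H →* Γ} {len : A → ℝ} {C : ℝ}
    (hι : ∀ a x, ι a * x = x * ι a) (hs : ∀ g h, ι (c g h) * s (g * h) = s g * s h)
    (hsurj : ∀ x, ∃ a, x = ι a * s (π x)) (len_mul : ∀ a b, len (a * b) ≤ len a + len b)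
    (len_inv : ∀ a, len a⁻¹ ≤ len a) (hC : ∀ g h, len (c g h) ≤ C) (l : List (H × H)) :
    ∃ a g, commutatorProd l = ι a * s g ∧ len a ≤ (4 * l.length + 1) * C := by
  induction l with
  | nil =>
    -- The section need not be normalized: `s 1 = ι (c 1 1)`. This accounts for the `+ 1` in the
    -- bound.
    refine ⟨(c 1 1)⁻¹, 1, ?_, by simpa using (len_inv _).trans (hC 1 1)⟩
    have h := hs 1 1
    rw [mul_one] at h
    rw [map_inv, mul_right_cancel h]
    simp [commutatorProd]
  | cons p l ih =>
    obtain ⟨a, k, hl, ha⟩ := ih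
    obtain ⟨x, y⟩ := p
    obtain ⟨a₁, hx⟩ := hsurj x
    obtain ⟨a₂, hy⟩ := hsurj y
    set g := π x
    set h := π y
    -- The central factors of `x` and `y` cancel in the commutator.
    have hxy : x * y * x⁻¹ * y⁻¹ = s g * s h * (s g)⁻¹ * (s h)⁻¹ := by
      have c1 : ∀ u v : H, ι a₁ * u * v * (ι a₁ * u)⁻¹ = u * v * u⁻¹ := fun u v => by
        rw [mul_assoc (ι a₁), hι a₁ (u * v), hι a₁ u]; group
      have c2 : ∀ u v : H, u * (ι a₂ * v) * u⁻¹ * (ι a₂ * v)⁻¹ = u * v * u⁻¹ * v⁻¹ :=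
        fun u v => by
          calc u * (ι a₂ * v) * u⁻¹ * (ι a₂ * v)⁻¹
              = u * ι a₂ * (v * u⁻¹ * v⁻¹) * (ι a₂)⁻¹ := by rw [mul_inv_rev]; simp only [mul_assoc]
            _ = u * v * u⁻¹ * v⁻¹ := by
              rw [← hι, mul_assoc (ι a₂), hι]; group
      rw [hx, hy, c1, c2]
    refine ⟨c g h * (c h g)⁻¹ * (c (g * h * g⁻¹ * h⁻¹) (h * g))⁻¹ *
      c (g * h * g⁻¹ * h⁻¹) k * a, g * h * g⁻¹ * h⁻¹ * k, ?_, ?_⟩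
    · have hcons : commutatorProd ((x, y) :: l) = x * y * x⁻¹ * y⁻¹ * commutatorProd l := by
        simp [commutatorProd]
      rw [hcons, hl, hxy, hι, ← mul_assoc, commutator_mul_section_eq hι hs, mul_assoc, ← hι,
        ← mul_assoc, ← map_mul]
    · refine (len_mul _ _).trans ?_
      refine (add_le_add ((len_mul _ _).trans (add_le_add ((len_mul _ _).trans (add_le_add
        ((len_mul _ _).trans (add_le_add (hC _ _) ((len_inv _).trans (hC _ _))))
        ((len_inv _).trans (hC _ _)))) (hC _ _))) ha).trans (le_of_eq ?_)
      push_cast [List.length_cons]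
      ring

theorem len_le_mul_commutatorLength {π : H →* Γ} {len : A → ℝ} {C : ℝ}
    (inj : Function.Injective ι) (hπι : ∀ a, π (ι a) = 1) (hπs : ∀ g, π (s g) = g)
    (hι : ∀ a x, ι a * x = x * ι a) (hs : ∀ g h, ι (c g h) * s (g * h) = s g * s h)
    (hsurj : ∀ x, ∃ a, x = ι a * s (π x)) (len_mul : ∀ a b, len (a * b) ≤ len a + len b)
    (len_inv : ∀ a, len a⁻¹ ≤ len a) (hC : ∀ g h, len (c g h) ≤ C) {z : A}
    (hz : ι z ∈ commutator H) : len z ≤ (4 * commutatorLength (ι z) + 2) * C := by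
  obtain ⟨l, hl, hlz⟩ := exists_length_eq_commutatorLength hz
  obtain ⟨a, g, hag, ha⟩ :=
    exists_commutatorProd_eq_mul_section hι hs hsurj len_mul len_inv hC l
  rw [hlz] at hag
  have hg : g = 1 := by
    have := congrArg π hag
    rwa [map_mul, hπι, hπι, hπs, one_mul, eq_comm] at this
  subst hg
  have h1 := hs 1 1
  rw [mul_one] at h1
  -- Replacing `s 1` by `ι (c 1 1)` costs one more value, whence `+ 2`.
  have hza : z = a * c 1 1 := inj (by rw [hag, map_mul, mul_right_cancel h1])
  rw [hl] at ha
  calc len z = len (a * c 1 1) := by rw [← hza]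
    _ ≤ (4 * commutatorLength (ι z) + 1) * C + C :=
      (len_mul _ _).trans (add_le_add ha (hC _ _))
    _ = _ := by ring

theorem stableLength_le_of_bounded {π : H →* Γ} {len : A → ℝ} {C : ℝ}
    (hlen : IsStandardLength len)
    (inj : Function.Injective ι) (hπι : ∀ a, π (ι a) = 1) (hπs : ∀ g, π (s g) = g)
    (hι : ∀ a x, ι a * x = x * ι a) (hs : ∀ g h, ι (c g h) * s (g * h) = s g * s h)
    (hsurj : ∀ x, ∃ a, x = ι a * s (π x)) (hC : ∀ g h, len (c g h) ≤ C) {z : A}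
    (hz : ι z ∈ commutator H) :
    stableLength len z ≤ 4 * C * stableCommutatorLength (ι z) := by
  have h2 : Tendsto (fun n : ℕ => 2 * C / (n : ℝ)) atTop (𝓝 0) :=
    tendsto_const_div_atTop_nhds_zero_nat _
  have h := ((tendsto_stableCommutatorLength hz).const_mul (4 * C)).add h2
  rw [add_zero] at h
  refine le_of_tendsto_of_tendsto' (hlen.tendsto_stableLength z) h fun n => ?_
  have hn := len_le_mul_commutatorLength inj hπι hπs hι hs hsurj hlen.mul_le hlen.inv_le hC
    (z := z ^ n) (by rw [map_pow]; exact pow_mem hz n)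
  rw [map_pow] at hn
  -- This also covers `n = 0`, where division by zero makes both sides 0.
  calc len (z ^ n) / n ≤ (4 * commutatorLength (ι z ^ n) + 2) * C / n := by gcongr
    _ = _ := by ring

end CentralExtension

/-! ### Cocycles that represent the obstruction class -/

section Obstruction

variable {G : Type u} [TopologicalSpace G] [Group G] [IsTopologicalGroup G]

theorem coveringMap_ofPath {g : G} (p : Path (1 : G) g) : coveringMap G (ofPath p) = g :=
  p.target

theorem coveringMap_toCover (a : FundamentalGroup G (1 : G)) : coveringMap G (toCover a) = 1 := by
  rw [← MonoidHom.mem_ker, ← range_toCover]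
  exact ⟨a, rfl⟩

/-- A cocycle in the class of the obstruction cocycle comes from a section of the covering
homomorphism. -/
theorem exists_section_of_toClass_eq (γ : ∀ g : G, Path (1 : G) g)
    {c : Cocycle G (FundamentalGroup G (1 : G))}
    (hc : c.toClass = (obstructionCocycle γ).toClass) :
    ∃ s : G → UniversalCover G, (∀ g, coveringMap G (s g) = g) ∧
      ∀ g h, toCover (c.val g h) * s (g * h) = s g * s h := by
  obtain ⟨b, hb⟩ := (groupCohomology.H2π_eq_iff _ _).1 hc
  let b' : G → FundamentalGroup G (1 : G) := fun g =>
    Additive.toMul (α := FundamentalGroup G (1 : G)) (b g)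
  have hcb : ∀ g h, b' h / b' (g * h) * b' g = c.val g h / obstructionCochain γ g h :=
    fun g h => congrArg (Additive.toMul (α := FundamentalGroup G (1 : G))) (congrFun hb (g, h))
  have hcb' : ∀ g h, c.val g h * b' (g * h) = b' g * b' h * obstructionCochain γ g h := by
    intro g h
    have := hcb g h
    rw [div_mul_eq_mul_div, div_eq_div_iff_mul_eq_mul] at this
    rw [← this, mul_comm (b' h)]
  -- The cocycles differ by the coboundary of `b'`, so twisting the section `γ` by `b'` realizes `c`
  -- exactly.
  refine ⟨fun g => toCover (b' g) * ofPath (γ g), fun g => ?_, fun g h => ?_⟩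
  · rw [map_mul, coveringMap_toCover, coveringMap_ofPath, one_mul]
  · rw [← mul_assoc, ← map_mul, hcb', map_mul, mul_assoc, toCover_obstructionCochain, map_mul toCover]
    simp only [mul_assoc]
    rw [← mul_assoc (toCover (b' h)) (ofPath (γ g)), toCover_central (b' h), mul_assoc]

theorem exists_eq_toCover_mul {s : G → UniversalCover G} (hs : ∀ g, coveringMap G (s g) = g)
    (x : UniversalCover G) : ∃ a, x = toCover a * s (coveringMap G x) := by
  have hx : x * (s (coveringMap G x))⁻¹ ∈ (toCover (G := G)).range := by
    rw [range_toCover, MonoidHom.mem_ker, map_mul, map_inv, hs, mul_inv_cancel]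
  obtain ⟨a, ha⟩ := hx
  exact ⟨a, by rw [ha, inv_mul_cancel_right]⟩

variable [PathConnectedSpace G] {len : FundamentalGroup G (1 : G) → ℝ}

theorem stableLength_le_of_cocycle (hlen : IsStandardLength len)
    {c : Cocycle G (FundamentalGroup G (1 : G))} (hc : c.toClass = obstructionClass G) {C : ℝ}
    (hC : ∀ g h, len (c.val g h) ≤ C) {z : FundamentalGroup G (1 : G)}
    (hz : toCover z ∈ commutator (UniversalCover G)) :
    stableLength len z ≤ 4 * C * stableCommutatorLength (toCover z) := by
  obtain ⟨s, hπs, hs⟩ := exists_section_of_toClass_eq _ hc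
  exact stableLength_le_of_bounded hlen toCover_injective coveringMap_toCover hπs toCover_central
    hs (exists_eq_toCover_mul hπs) hC hz

theorem supNorm_ne_top {Γ A : Type u} [Group Γ] [CommGroup A] {len : A → ℝ} {α : H2 Γ A}
    (h : IsBoundedClass len α) : supNorm len α ≠ ⊤ := by
  obtain ⟨c, hc, C, hC⟩ := h
  refine ne_top_of_le_ne_top (ENNReal.ofReal_ne_top (r := C)) ?_
  exact (iInf₂_le c hc).trans (iSup₂_le fun g h => ENNReal.ofReal_le_ofReal (hC g h))

/-- The norm of a bounded class is approximated by bounds on representing cocycles. -/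
theorem exists_cocycle_le_of_supNorm_lt {Γ A : Type u} [Group Γ] [CommGroup A] {len : A → ℝ}
    {α : H2 Γ A} (h : IsBoundedClass len α) {r : ℝ} (hr : (supNorm len α).toReal < r) :
    ∃ c : Cocycle Γ A, c.toClass = α ∧ ∀ g h, len (c.val g h) ≤ r := by
  have hr0 : 0 ≤ r := ENNReal.toReal_nonneg.trans hr.le
  have hlt : supNorm len α < ENNReal.ofReal r :=
    (ENNReal.lt_ofReal_iff_toReal_lt (supNorm_ne_top h)).2 hr
  obtain ⟨c, hc⟩ := iInf_lt_iff.1 hlt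
  obtain ⟨hcα, hc⟩ := iInf_lt_iff.1 hc
  refine ⟨c, hcα, fun g k => (ENNReal.ofReal_le_ofReal_iff hr0).1 (le_trans ?_ hc.le)⟩
  exact le_iSup₂ (f := fun g k => ENNReal.ofReal (len (c.val g k))) g k

theorem stableLength_le_supNorm_mul (hlen : IsStandardLength len)
    (hb : IsBoundedClass len (obstructionClass G)) {z : FundamentalGroup G (1 : G)}
    (hz : toCover z ∈ commutator (UniversalCover G)) :
    stableLength len z ≤
      4 * (supNorm len (obstructionClass G)).toReal * stableCommutatorLength (toCover z) := by
  set N := (supNorm len (obstructionClass G)).toReal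
  -- The infimum need not be known to be attained: every `r > N` bounds some representative, and
  -- then `r` tends to `N`.
  have hcont : Tendsto (fun r : ℝ => 4 * r * stableCommutatorLength (toCover z)) (𝓝[>] N)
      (𝓝 (4 * N * stableCommutatorLength (toCover z))) :=
    (Continuous.tendsto (by fun_prop) N).mono_left nhdsWithin_le_nhds
  refine ge_of_tendsto hcont ?_
  filter_upwards [self_mem_nhdsWithin] with r hr
  obtain ⟨c, hc, hC⟩ := exists_cocycle_le_of_supNorm_lt hb hr
  exact stableLength_le_of_cocycle hlen hc hC hz

end Obstruction

end FlatObstruction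

theorem proposition3p3
    {E : Type*} [NormedAddCommGroup E] [NormedSpace ℝ E] [FiniteDimensional ℝ E]
    {G : Type u} [TopologicalSpace G] [ChartedSpace E G] [Group G] [LieGroup 𝓘(ℝ, E) ∞ G]
    [ConnectedSpace G] :
    haveI : IsTopologicalGroup G := topologicalGroup_of_lieGroup 𝓘(ℝ, E) ∞
    haveI : PathConnectedSpace G := FlatObstruction.pathConnectedSpace_of_manifold E G
    ∀ len : FundamentalGroup G (1 : G) → ℝ, FlatObstruction.IsStandardLength len →
    FlatObstruction.IsBoundedClass len (FlatObstruction.obstructionClass G) →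
    ∀ z : FundamentalGroup G (1 : G), ¬ IsOfFinOrder z →
    FlatObstruction.toCover z ∈ commutator (FlatObstruction.UniversalCover G) →
      Tendsto (fun n : ℕ => len (z ^ n) / n) atTop
        (𝓝 (FlatObstruction.stableLength len z)) ∧
      Tendsto (fun n : ℕ =>
          (FlatObstruction.commutatorLength (FlatObstruction.toCover z ^ n) : ℝ) / n) atTop
        (𝓝 (FlatObstruction.stableCommutatorLength (FlatObstruction.toCover z))) ∧
      FlatObstruction.stableCommutatorLength (FlatObstruction.toCover z) ≥
        1 / (4 * (FlatObstruction.supNorm len (FlatObstruction.obstructionClass G)).toReal) *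
          FlatObstruction.stableLength len z ∧
      1 / (4 * (FlatObstruction.supNorm len (FlatObstruction.obstructionClass G)).toReal) *
          FlatObstruction.stableLength len z > 0 := by
  have : IsTopologicalGroup G := topologicalGroup_of_lieGroup 𝓘(ℝ, E) ∞
  have : PathConnectedSpace G := FlatObstruction.pathConnectedSpace_of_manifold E G
  intro len hlen hb z hz hzc
  have hpos := hlen.stableLength_pos hz
  have hle := FlatObstruction.stableLength_le_supNorm_mul hlen hb hzc
  -- A zero norm would force the stable length to be at most 0. Positivity keeps the reciprocal from
  -- being the default `1 / 0 = 0`.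
  have hN : 0 < (FlatObstruction.supNorm len (FlatObstruction.obstructionClass G)).toReal := by
    refine ENNReal.toReal_nonneg.lt_of_ne fun h => ?_
    rw [← h, mul_zero, zero_mul] at hle
    exact hpos.not_ge hle
  refine ⟨hlen.tendsto_stableLength z, FlatObstruction.tendsto_stableCommutatorLength hzc, ?_,
    by positivity⟩
  rw [ge_iff_le, one_div, inv_mul_le_iff₀ (by positivity)]
  exact hle
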